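/- Let $n\ge 2$, $0<T<\infty$ and $\mathbb{R}^n_T=\mathbb{R}^n\times(0,T)$. Let $S^{n\times n}$ be the set of real symmetric $n\times n$ matrices with its usual order, $I$ the identity matrix, $O$ the zero matrix, and $(q\otimes q)_{ij}=q_iq_j$. Let $H:\mathbb{R}^n\times S^{n\times n}\to\mathbb{R}$ satisfy the following conditions. - (A) $H$ is continuous, $H(q,X)\le H(q,Y)$ whenever $X\le Y$, and $H(q,O)=0$ for all $q$. - (B) with $k_1=0$, i.e. $k=k_1+1=1$: $H(\theta q,X)=H(q,X)$ for all $\theta\in\mathbb{R}$ (so $H(q,X)=H(X)$ does not depend on $q$), and $H(q,\theta X)=\theta H(q,X)$ for all $\theta>0$. - (C) $\max_{|e|=1}H(e,-I)<0<\min_{|e|=1}H(e,I)$, and $\Lambda^{\sup}:=\sup_{\lambda\in\mathbb{R}}\max_{|e|=1}H(e,\lambda e\otimes e+I)<\infty$. Put $\Lambda^{\inf}:=\inf_{\lambda\in\mathbb{R}}\min_{|e|=1}H(e,\lambda e\otimes e-I)$. Let $Z:\mathbb{R}\to[0,\infty)$ be continuous and non-increasing, $\chi:(0,T)\to\mathbb{R}$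 continuous and bounded, $\sigma\ge 0$, and $h:\mathbb{R}^n\to\mathbb{R}$ continuous with $\inf_{\mathbb{R}^n}h>-\infty$. Let $u:\mathbb{R}^n\times[0,T)\to\mathbb{R}$ be lower semicontinuous, with $u(x,0)\ge h(x)$ for all $x\in\mathbb{R}^n$, and let $u$ be a viscosity super-solution in $\mathbb{R}^n_T$ of $$H(D^2u+Z(u)\,Du\otimes Du)+\chi(t)|Du|^\sigma-u_t\le 0$$ (where $|Du|^0=1$ if $\sigma=0$). Fix $z\in\mathbb{R}^n$ and set $B^R_T=\{(x,t):|x-z|\le R,\ 0<t<T\}$ and $m(R)=\sup_{B^R_T}(-u)$. For $s>0$, $m(R)=e^{o(R^s)}$ means that $m(R)$ is finite for all $R$ and $\log m(R)^+=o(R^s)$ as $R\to\infty$, i.e. for every $\varepsilon>0$ one has $m(R)\le e^{\varepsilon R^s}$ for all large $R$; similarly, $m(R)=o(R^s)$ includes that $m(R)$ is finite for all $R$. Then the following hold. (a) If $\Lambda^{\inf}>-\infty$, $\sigma=0$ and $m(R)=e^{o(R^2)}$ as $R\to\infty$, then $$u(x,t)\ge\inf_{\mathbb{R}^n}h-t\,\sup_{(0,T)}|\chi|\qquad\text{for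 all }(x,t)\in\mathbb{R}^n_T.$$ (b) If $\Lambda^{\inf}>-\infty$, $0<\sigma\le 1$ and $m(R)=e^{o(R)}$ as $R\to\infty$, then $u(x,t)\ge\inf_{\mathbb{R}^n}h$ for all $(x,t)\in\mathbb{R}^n_T$. (c) If $1<\sigma<\infty$ and $m(R)=o(R^{\sigma^*})$ as $R\to\infty$, where $\sigma^*=\sigma/(\sigma-1)$, then $u(x,t)\ge\inf_{\mathbb{R}^n}h$ for all $(x,t)\in\mathbb{R}^n_T$. No condition on $\Lambda^{\inf}$ is imposed here. -/

import Mathlib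

open Set Filter Topology Asymptotics

/-- `n × n` real matrices. The operators below are only ever evaluated at symmetric ones. -/
abbrev RMat (n : ℕ) := Matrix (Fin n) (Fin n) ℝ

/-- The matrix `q ⊗ q`, with entries `qᵢ qⱼ`. -/
def tensorSq {n : ℕ} (q : EuclideanSpace ℝ (Fin n)) : RMat n :=
  Matrix.of fun i j => q i * q j

/-- The quadratic form `⟨X y, y⟩` of a matrix `X`. -/
def quadForm {n : ℕ} (X : RMat n) (y : EuclideanSpace ℝ (Fin n)) : ℝ :=
  ∑ i, ∑ j, X i j * y i * y j

/-- Condition A: `H` is continuous on `ℝⁿ × Sⁿˣⁿ`, non-decreasing in the symmetric matrix `X`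
(for the order `X ≤ Y` iff `Y - X` is positive semidefinite), and `H(q, O) = 0`. -/
structure ConditionA {n : ℕ} (H : EuclideanSpace ℝ (Fin n) → RMat n → ℝ) : Prop where
  continuousOn : ContinuousOn (fun p : EuclideanSpace ℝ (Fin n) × RMat n => H p.1 p.2)
    {p | p.2.IsSymm}
  mono : ∀ (q : EuclideanSpace ℝ (Fin n)) (X Y : RMat n),
    X.IsSymm → Y.IsSymm → (Y - X).PosSemidef → H q X ≤ H q Y
  zero : ∀ q : EuclideanSpace ℝ (Fin n), H q 0 = 0

/-- Condition B: `H` is homogeneous of degree `k₁ ≥ 0` in `q` and positively homogeneous of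
degree one in `X`. (For `k₁ = 0` the power `|θ| ^ 0` is `1`, also at `θ = 0`.) -/
structure ConditionB {n : ℕ} (H : EuclideanSpace ℝ (Fin n) → RMat n → ℝ) (k₁ : ℝ) : Prop where
  nonneg : 0 ≤ k₁
  homog_left : ∀ (θ : ℝ) (q : EuclideanSpace ℝ (Fin n)) (X : RMat n),
    X.IsSymm → H (θ • q) X = |θ| ^ k₁ * H q X
  homog_right : ∀ (θ : ℝ) (q : EuclideanSpace ℝ (Fin n)) (X : RMat n),
    0 < θ → X.IsSymm → H q (θ • X) = θ * H q X

/-- `Λ_max(λ) = max_{|e| = 1} H(e, λ e ⊗ e + I)`. -/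
noncomputable def lambdaMax {n : ℕ} (H : EuclideanSpace ℝ (Fin n) → RMat n → ℝ) (l : ℝ) : ℝ :=
  sSup ((fun e => H e (l • tensorSq e + 1)) '' Metric.sphere (0 : EuclideanSpace ℝ (Fin n)) 1)

/-- `Λ_min(λ) = min_{|e| = 1} H(e, λ e ⊗ e - I)`. -/
noncomputable def lambdaMin {n : ℕ} (H : EuclideanSpace ℝ (Fin n) → RMat n → ℝ) (l : ℝ) : ℝ :=
  sInf ((fun e => H e (l • tensorSq e - 1)) '' Metric.sphere (0 : EuclideanSpace ℝ (Fin n)) 1)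

/-- `Λ^sup = sup_λ Λ_max(λ)` is finite. -/
def LambdaSupFinite {n : ℕ} (H : EuclideanSpace ℝ (Fin n) → RMat n → ℝ) : Prop :=
  BddAbove (range (lambdaMax H))

/-- `Λ^inf = inf_λ Λ_min(λ)` is finite. -/
def LambdaInfFinite {n : ℕ} (H : EuclideanSpace ℝ (Fin n) → RMat n → ℝ) : Prop :=
  BddBelow (range (lambdaMin H))

/-- Condition C: `max_{|e| = 1} H(e, -I) < 0 < min_{|e| = 1} H(e, I)` and `Λ^sup < ∞`. -/
structure ConditionC {n : ℕ} (H : EuclideanSpace ℝ (Fin n) → RMat n → ℝ) : Prop where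
  neg : sSup ((fun e => H e (-1)) '' Metric.sphere (0 : EuclideanSpace ℝ (Fin n)) 1) < 0
  pos : 0 < sInf ((fun e => H e 1) '' Metric.sphere (0 : EuclideanSpace ℝ (Fin n)) 1)
  lambdaSup : LambdaSupFinite H

/-- The operator `𝒫_σ(t, r, a, q, X) = H(q, X + Z(r) q ⊗ q) + χ(t) |q|^σ - a`, to be evaluated at
`r = u`, `a = u_t`, `q = Du`, `X = D²u`. For `σ = 0` the factor `|q|^σ` is `1`. -/
noncomputable def parabolicOp {n : ℕ} (H : EuclideanSpace ℝ (Fin n) → RMat n → ℝ)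
    (Z χ : ℝ → ℝ) (σ t r a : ℝ) (q : EuclideanSpace ℝ (Fin n)) (X : RMat n) : ℝ :=
  H q (X + Z r • tensorSq q) + χ t * ‖q‖ ^ σ - a

/-- `(a, q, X)` belongs to the parabolic second order subjet `P^{2,-} u(x₀, t₀)`: `X` is symmetric
and, as `(x, t) → (x₀, t₀)`,
`u(x, t) ≥ u(x₀, t₀) + a (t - t₀) + ⟨q, x - x₀⟩ + ½ ⟨X (x - x₀), x - x₀⟩`
`+ o(|t - t₀| + |x - x₀|²)`. -/
def IsParabolicSubjet {n : ℕ} (u : EuclideanSpace ℝ (Fin n) × ℝ → ℝ)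
    (x₀ : EuclideanSpace ℝ (Fin n)) (t₀ a : ℝ) (q : EuclideanSpace ℝ (Fin n)) (X : RMat n) :
    Prop :=
  X.IsSymm ∧ ∀ ε : ℝ, 0 < ε → ∀ᶠ y : EuclideanSpace ℝ (Fin n) × ℝ in 𝓝 (x₀, t₀),
    u (x₀, t₀) + a * (y.2 - t₀) + inner ℝ q (y.1 - x₀) + 1 / 2 * quadForm X (y.1 - x₀)
      - ε * (|y.2 - t₀| + ‖y.1 - x₀‖ ^ 2) ≤ u y

/-- `u` is a viscosity super-solution of `𝒫_σ(t, u, u_t, Du, D²u) ≤ 0` in `ℝⁿ × (0, T)`: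
it is lower semicontinuous there and satisfies the inequality on all its parabolic subjets. -/
def IsViscositySupersolution {n : ℕ} (H : EuclideanSpace ℝ (Fin n) → RMat n → ℝ)
    (Z χ : ℝ → ℝ) (σ T : ℝ) (u : EuclideanSpace ℝ (Fin n) × ℝ → ℝ) : Prop :=
  LowerSemicontinuousOn u (univ ×ˢ Ioo 0 T) ∧
    ∀ (x : EuclideanSpace ℝ (Fin n)) (t : ℝ), t ∈ Ioo 0 T →
      ∀ (a : ℝ) (q : EuclideanSpace ℝ (Fin n)) (X : RMat n),
        IsParabolicSubjet u x t a q X → parabolicOp H Z χ σ t (u (x, t)) a q X ≤ 0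

/-- The cylinder `B_T^R = {(x, t) : |x - z| ≤ R, 0 < t < T}`. -/
def cylinder {n : ℕ} (z : EuclideanSpace ℝ (Fin n)) (T R : ℝ) :
    Set (EuclideanSpace ℝ (Fin n) × ℝ) :=
  Metric.closedBall z R ×ˢ Ioo 0 T

/-- `sup_{B_T^R} f = o(R^s)` as `R → ∞`; in particular the suprema are finite. -/
def SupIsLittleO {n : ℕ} (f : EuclideanSpace ℝ (Fin n) × ℝ → ℝ)
    (z : EuclideanSpace ℝ (Fin n)) (T s : ℝ) : Prop :=
  (∀ R : ℝ, BddAbove (f '' cylinder z T R)) ∧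
    (fun R : ℝ => sSup (f '' cylinder z T R)) =o[atTop] fun R : ℝ => R ^ s

/-- `sup_{B_T^R} f = e^{o(R^s)}` as `R → ∞`, that is, `log ((sup_{B_T^R} f)⁺) = o(R^s)`; in
particular the suprema are finite. A supremum that is `≤ 0` for all `R` is allowed (`Real.log 0`
is `0`); since the supremum is non-decreasing in `R`, the condition says exactly that for each
`ε > 0` it is at most `e^{ε R^s}` for all large `R`. -/
def SupIsExpLittleO {n : ℕ} (f : EuclideanSpace ℝ (Fin n) × ℝ → ℝ)
    (z : EuclideanSpace ℝ (Fin n)) (T s : ℝ) : Prop :=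
  (∀ R : ℝ, BddAbove (f '' cylinder z T R)) ∧
    (fun R : ℝ => Real.log (max (sSup (f '' cylinder z T R)) 0)) =o[atTop] fun R : ℝ => R ^ s

/-! The proof compares `u` with explicit strict sub-solutions `v = c - κ t - ε e^{bt} G(|x - z|²) -
η/(T - t)`, where `c = inf h`. Since `Z ≥ 0` and `H` is monotone, the term `Z(u) Du ⊗ Du` only
raises the operator, so it suffices that `v` be strict for `H(D²v) + χ|Dv|^σ - v_t`. The factor
`e^{bt}` contributes `b ε e^{bt} G` to `-v_t`; this pays for the second-order and gradient terms as
soon as both are bounded by multiples of `G`, up to the constant `κ`. The growth condition says that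
`ε G(R²)` eventually beats `-u`, so `v ≤ u` on the side of a large cylinder, and `η/(T - t)` settles
the top. Letting the small parameters tend to `0` gives the bound.

The core is `IsViscositySupersolution.barrier_le`. In (a) and (b) `G` is `e^s` and `e^{√(1+s)}`, and
finiteness of `Λ^inf` makes the rank-one part of `D²v` harmless (`exists_bound_of_lambdaInfFinite`).
In (c) `G = (1+s)^{σ*/2}`: both eigenvalues of its Hessian are at most a multiple of `G`, so
comparison with `-I` suffices (`le_neg_of_eigenvalues_le`). -/

section Matrices

/-! ### Matrices of the form `a I + b y ⊗ y`, which include the Hessians of radial functions. -/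

variable {n : ℕ}

lemma tensorSq_isSymm (q : EuclideanSpace ℝ (Fin n)) : (tensorSq q).IsSymm := by
  ext i j
  simp [tensorSq, mul_comm]

lemma smul_one_add_smul_tensorSq_isSymm (a b : ℝ) (y : EuclideanSpace ℝ (Fin n)) :
    (a • (1 : RMat n) + b • tensorSq y).IsSymm :=
  (Matrix.isSymm_one.smul a).add ((tensorSq_isSymm y).smul b)

lemma tensorSq_smul (c : ℝ) (y : EuclideanSpace ℝ (Fin n)) :
    tensorSq (c • y) = c ^ 2 • tensorSq y := by
  ext i j
  simp [tensorSq]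
  ring

lemma sum_coord_mul_eq_inner (y x : EuclideanSpace ℝ (Fin n)) :
    ∑ i, y i * x i = inner ℝ y x := by
  simp [PiLp.inner_apply, mul_comm]

lemma quadForm_smul_one_add_smul_tensorSq (a b : ℝ) (y x : EuclideanSpace ℝ (Fin n)) :
    quadForm (a • (1 : RMat n) + b • tensorSq y) x = a * ‖x‖ ^ 2 + b * inner ℝ y x ^ 2 := by
  have h1 : ‖x‖ ^ 2 = ∑ i, ∑ j, (1 : RMat n) i j * x i * x j := by
    simp only [Matrix.one_apply, ite_mul, one_mul, zero_mul, Finset.sum_ite_eq,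
      Finset.mem_univ, if_true]
    rw [EuclideanSpace.norm_sq_eq]
    simp [sq]
  have h2 : inner ℝ y x ^ 2 = ∑ i, ∑ j, tensorSq y i j * x i * x j := by
    rw [← sum_coord_mul_eq_inner, sq, Finset.sum_mul_sum]
    refine Finset.sum_congr rfl fun i _ => Finset.sum_congr rfl fun j _ => ?_
    simp [tensorSq]
    ring
  rw [h1, h2, quadForm, Finset.mul_sum, Finset.mul_sum, ← Finset.sum_add_distrib]
  refine Finset.sum_congr rfl fun i _ => ?_
  rw [Finset.mul_sum, Finset.mul_sum, ← Finset.sum_add_distrib]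
  refine Finset.sum_congr rfl fun j _ => ?_
  simp
  ring

lemma posSemidef_of_quadForm_nonneg {X : RMat n} (hX : X.IsSymm)
    (h : ∀ x, 0 ≤ quadForm X x) : X.PosSemidef := by
  refine Matrix.PosSemidef.of_dotProduct_mulVec_nonneg ?_ fun x => ?_
  · rw [Matrix.IsHermitian, Matrix.conjTranspose_eq_transpose_of_trivial]
    exact hX
  · have := h (WithLp.toLp 2 x)
    refine this.trans_eq ?_
    simp only [quadForm, dotProduct, Matrix.mulVec, star_trivial, Finset.mul_sum]
    refine Finset.sum_congr rfl fun i _ => Finset.sum_congr rfl fun j _ => ?_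
    ring

/-- `a I + b y ⊗ y` is positive semidefinite as soon as its eigenvalues `a` and `a + b |y|²` are
non-negative. -/
lemma posSemidef_smul_one_add_smul_tensorSq {a b : ℝ} {y : EuclideanSpace ℝ (Fin n)}
    (ha : 0 ≤ a) (hab : 0 ≤ a + b * ‖y‖ ^ 2) :
    (a • (1 : RMat n) + b • tensorSq y).PosSemidef := by
  refine posSemidef_of_quadForm_nonneg (smul_one_add_smul_tensorSq_isSymm a b y) fun x => ?_
  rw [quadForm_smul_one_add_smul_tensorSq]
  have hcs : inner ℝ y x ^ 2 ≤ ‖y‖ ^ 2 * ‖x‖ ^ 2 := by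
    rw [← mul_pow, ← sq_abs]
    exact pow_le_pow_left₀ (abs_nonneg _) (abs_real_inner_le_norm y x) 2
  rcases le_total 0 b with hb | hb
  · positivity
  · nlinarith [mul_nonneg hab (sq_nonneg ‖x‖), mul_nonneg (neg_nonneg.2 hb) (sub_nonneg.2 hcs)]

end Matrices

/-! ### Lower bounds for `H` on such Hessians. -/

section Operator

variable {n : ℕ} {H : EuclideanSpace ℝ (Fin n) → RMat n → ℝ}

/-- Homogeneity is applied with `θ = 0`: as `0 ^ 0 = 1` for real powers, both sides equal `H 0 X`.
-/
lemma ConditionB.eq_of_isSymm (hB : ConditionB H 0) {X : RMat n} (hX : X.IsSymm)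
    (p q : EuclideanSpace ℝ (Fin n)) : H p X = H q X := by
  have h1 := hB.homog_left 0 p X hX
  have h2 := hB.homog_left 0 q X hX
  simp only [zero_smul, Real.rpow_zero, one_mul] at h1 h2
  rw [← h1, h2]

/-- Removes the dependence on `u` itself: `Z r • q ⊗ q` is positive semidefinite, so a barrier need
only be tested without it. -/
lemma ConditionA.le_parabolicOp (hA : ConditionA H) {Z χ : ℝ → ℝ} {σ t r a : ℝ}
    (hZ : 0 ≤ Z r) (q : EuclideanSpace ℝ (Fin n)) {X : RMat n} (hX : X.IsSymm) :
    H q X + χ t * ‖q‖ ^ σ - a ≤ parabolicOp H Z χ σ t r a q X := by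
  have h : H q X ≤ H q (X + Z r • tensorSq q) := by
    refine hA.mono q _ _ hX (hX.add ((tensorSq_isSymm q).smul _)) ?_
    have := posSemidef_smul_one_add_smul_tensorSq (n := n) (a := 0) (b := Z r) (y := q) le_rfl
      (by positivity)
    simpa using this
  simp only [parabolicOp]
  linarith

/-- If `a I + b y ⊗ y ≤ τ I`, then `H(-(a I + b y ⊗ y)) ≥ τ H(-I)`. -/
lemma le_neg_of_eigenvalues_le (hA : ConditionA H) (hB : ConditionB H 0)
    (q y : EuclideanSpace ℝ (Fin n)) {a b τ : ℝ} (hτ : 0 < τ) (ha : a ≤ τ)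
    (hab : a + b * ‖y‖ ^ 2 ≤ τ) :
    τ * H 0 (-1) ≤ H q (-(a • 1 + b • tensorSq y)) := by
  have hs : (-1 : RMat n).IsSymm := Matrix.isSymm_one.neg
  rw [hB.eq_of_isSymm hs 0 q, ← hB.homog_right τ q _ hτ hs]
  refine hA.mono q _ _ (hs.smul τ) (smul_one_add_smul_tensorSq_isSymm a b y).neg ?_
  convert posSemidef_smul_one_add_smul_tensorSq (n := n) (a := τ - a) (b := -b) (y := y)
    (by linarith) (by linarith) using 1
  module

/-- With `y = c e` and `|e| = 1`, factoring out `a` leaves `λ e ⊗ e - I` with `λ = -b c²/a`, which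
`Λ^inf` controls for every `λ`. Hence the bound is independent of `b` and `y`, however large the
rank-one part. -/
lemma exists_bound_of_lambdaInfFinite (hn : 2 ≤ n) (hA : ConditionA H) (hB : ConditionB H 0)
    (hI : LambdaInfFinite H) :
    ∃ C : ℝ, 0 ≤ C ∧ ∀ (q y : EuclideanSpace ℝ (Fin n)) (a b : ℝ), 0 < a → 0 ≤ b →
      -C * a ≤ H q (-(a • 1 + b • tensorSq y)) := by
  obtain ⟨m, hm⟩ := hI
  refine ⟨|m|, abs_nonneg m, fun q y a b ha hb => ?_⟩
  have unit_bound : ∀ (e : EuclideanSpace ℝ (Fin n)) (l : ℝ), ‖e‖ = 1 →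
      m ≤ H e (l • tensorSq e - 1) := by
    intro e l he
    refine (hm ⟨l, rfl⟩).trans (csInf_le ?_ ⟨e, by simpa using he, rfl⟩)
    refine ((isCompact_sphere _ _).image_of_continuousOn ?_).bddBelow
    have hc : Continuous fun e : EuclideanSpace ℝ (Fin n) => (e, l • tensorSq e - (1 : RMat n)) := by
      refine continuous_id.prodMk (Continuous.sub (Continuous.const_smul ?_ l) continuous_const)
      refine continuous_pi fun i => continuous_pi fun j => ?_
      simp only [tensorSq, Matrix.of_apply]
      fun_prop
    exact hA.continuousOn.comp hc.continuousOn
      fun x _ => ((tensorSq_isSymm x).smul l).sub Matrix.isSymm_one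
  obtain ⟨e, c, he, hy⟩ : ∃ (e : EuclideanSpace ℝ (Fin n)) (c : ℝ), ‖e‖ = 1 ∧ y = c • e := by
    rcases eq_or_ne y 0 with rfl | hy
    · have : Nonempty (Fin n) := ⟨⟨0, by omega⟩⟩
      obtain ⟨e, he⟩ := exists_norm_eq (EuclideanSpace ℝ (Fin n)) zero_le_one
      exact ⟨e, 0, he, by simp⟩
    · refine ⟨‖y‖⁻¹ • y, ‖y‖, ?_, ?_⟩
      · rw [norm_smul, norm_inv, norm_norm, inv_mul_cancel₀ (norm_ne_zero_iff.2 hy)]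
      · rw [smul_smul, mul_inv_cancel₀ (norm_ne_zero_iff.2 hy), one_smul]
  have hX : (-(b * c ^ 2 / a) • tensorSq e - (1 : RMat n)).IsSymm :=
    ((tensorSq_isSymm e).smul _).sub Matrix.isSymm_one
  have key : -(a • (1 : RMat n) + b • tensorSq y)
      = a • (-(b * c ^ 2 / a) • tensorSq e - 1) := by
    rw [hy, tensorSq_smul, smul_sub, smul_smul, smul_smul]
    have : a * -(b * c ^ 2 / a) = -(b * c ^ 2) := by field_simp
    rw [this]
    module
  rw [key, hB.homog_right a q _ ha hX, hB.eq_of_isSymm hX q e]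
  nlinarith [unit_bound e (-(b * c ^ 2 / a)) he, neg_abs_le m]

end Operator

/-! ### Comparison on bounded cylinders and subjets of radial barriers. -/

section Subjets

variable {n : ℕ}

lemma IsParabolicSubjet.of_isLocalMin {u v : EuclideanSpace ℝ (Fin n) × ℝ → ℝ}
    {x : EuclideanSpace ℝ (Fin n)} {t a : ℝ} {q : EuclideanSpace ℝ (Fin n)} {X : RMat n}
    (hv : IsParabolicSubjet v x t a q X)
    (hmin : ∀ᶠ y in 𝓝 (x, t), u (x, t) - v (x, t) ≤ u y - v y) :
    IsParabolicSubjet u x t a q X := by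
  refine ⟨hv.1, fun ε hε => ?_⟩
  filter_upwards [hmin, hv.2 ε hε] with y h1 h2
  linarith

/-- Comparison on a bounded cylinder with a function `v` whose subjets violate the
super-solution inequality. -/
lemma IsViscositySupersolution.le_of_le_boundary
    {H : EuclideanSpace ℝ (Fin n) → RMat n → ℝ} {Z χ : ℝ → ℝ} {σ T : ℝ}
    {u v : EuclideanSpace ℝ (Fin n) × ℝ → ℝ}
    (hu : IsViscositySupersolution H Z χ σ T u)
    (hulsc : LowerSemicontinuousOn u (univ ×ˢ Ico 0 T))
    (hvcont : ContinuousOn v (univ ×ˢ Ico 0 T))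
    (hv : ∀ x, ∀ t ∈ Ioo 0 T, ∃ a q X, IsParabolicSubjet v x t a q X ∧
      0 < parabolicOp H Z χ σ t (u (x, t)) a q X)
    {z : EuclideanSpace ℝ (Fin n)} {R τ : ℝ} (hτT : τ < T)
    (hbot : ∀ x, v (x, 0) ≤ u (x, 0))
    (htop : ∀ x, ‖x - z‖ ≤ R → v (x, τ) ≤ u (x, τ))
    (hside : ∀ x, ‖x - z‖ = R → ∀ t ∈ Ioo 0 T, v (x, t) ≤ u (x, t))
    {x : EuclideanSpace ℝ (Fin n)} (hx : ‖x - z‖ ≤ R) {t : ℝ} (ht : t ∈ Icc 0 τ) :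
    v (x, t) ≤ u (x, t) := by
  set K : Set (EuclideanSpace ℝ (Fin n) × ℝ) := Metric.closedBall z R ×ˢ Icc 0 τ
  have hK : IsCompact K := (isCompact_closedBall z R).prod isCompact_Icc
  have hKsub : K ⊆ univ ×ˢ Ico 0 T := fun p hp => ⟨mem_univ _, hp.2.1, hp.2.2.trans_lt hτT⟩
  have hmem : (x, t) ∈ K := ⟨by simpa [dist_eq_norm] using hx, ht⟩
  have hlsc : LowerSemicontinuousOn (fun p => u p + -v p) K :=
    (hulsc.mono hKsub).add (hvcont.mono hKsub).neg.lowerSemicontinuousOn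
  obtain ⟨⟨x₀, t₀⟩, hp, hmin⟩ := hlsc.exists_isMinOn ⟨_, hmem⟩ hK
  have hp1 : ‖x₀ - z‖ ≤ R := by simpa [dist_eq_norm] using hp.1
  suffices h : v (x₀, t₀) ≤ u (x₀, t₀) by
    have h2 : u (x₀, t₀) + -v (x₀, t₀) ≤ u (x, t) + -v (x, t) := hmin hmem
    linarith
  obtain ⟨h0, h1⟩ : 0 ≤ t₀ ∧ t₀ ≤ τ := hp.2
  rcases h0.eq_or_lt with rfl | h0
  · exact hbot x₀
  rcases h1.eq_or_lt with rfl | h1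
  · exact htop x₀ hp1
  have ht₀ : t₀ ∈ Ioo 0 T := ⟨h0, h1.trans hτT⟩
  rcases hp1.eq_or_lt with hR | hR
  · exact hside x₀ hR t₀ ht₀
  -- An interior minimum of `u - v` is impossible whatever its sign: `v` touches `u` from below up
  -- to a constant, so its subjet passes to `u`.
  obtain ⟨a, q, X, hsub, hpos⟩ := hv x₀ t₀ ht₀
  have hnhds : K ∈ 𝓝 (x₀, t₀) :=
    prod_mem_nhds (Metric.closedBall_mem_nhds_of_mem (by simpa [dist_eq_norm] using hR))
      (Icc_mem_nhds h0 h1)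
  refine absurd (hu.2 x₀ t₀ ht₀ a q X (hsub.of_isLocalMin ?_)) hpos.not_ge
  filter_upwards [hnhds] with y hy
  have h2 : u (x₀, t₀) + -v (x₀, t₀) ≤ u y + -v y := hmin hy
  linarith

/-- Second order Taylor expansion with Peano remainder. -/
lemma taylor_two_isLittleO {G G₁ : ℝ → ℝ} {s₀ g₂ : ℝ}
    (hG : ∀ᶠ s in 𝓝 s₀, HasDerivAt G (G₁ s) s) (hG₁ : HasDerivAt G₁ g₂ s₀) :
    (fun s => G s - G s₀ - G₁ s₀ * (s - s₀) - g₂ / 2 * (s - s₀) ^ 2)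
      =o[𝓝 s₀] fun s => (s - s₀) ^ 2 := by
  obtain ⟨r, hr, hball⟩ := Metric.eventually_nhds_iff_ball.1 hG
  have hnh : 𝓝[Metric.ball s₀ r] s₀ = 𝓝 s₀ :=
    nhdsWithin_eq_nhds.2 (Metric.ball_mem_nhds s₀ hr)
  -- The remainder has derivative `o(s - s₀)`, so a mean value estimate gains one power.
  have h := (convex_ball s₀ r).isLittleO_pow_succ_real (n := 1)
    (f := fun s => G s - G s₀ - G₁ s₀ * (s - s₀) - g₂ / 2 * (s - s₀) ^ 2)
    (f' := fun s => G₁ s - G₁ s₀ - g₂ * (s - s₀)) (Metric.mem_ball_self hr)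
    (fun s hs => by
      have h1 := (((hball s hs).sub_const (G s₀)).sub
        (((hasDerivAt_id s).sub_const s₀).const_mul (G₁ s₀))).sub
        ((((hasDerivAt_id s).sub_const s₀).pow 2).const_mul (g₂ / 2))
      refine (h1.congr_deriv ?_).hasDerivWithinAt
      simp
      ring)
    (by
      rw [hnh]
      have := hG₁.isLittleO
      simpa [mul_comm] using this)
  rw [hnh] at h
  simpa using h

/-- The subjet of `-(ζ(t) + E(t) G(|x - z|²))` given by its derivatives. -/
lemma isParabolicSubjet_radial {G G₁ E ζ : ℝ → ℝ} {g₂ e₁ ζ₁ t₀ : ℝ}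
    (z x₀ : EuclideanSpace ℝ (Fin n))
    (hG : ∀ᶠ s in 𝓝 (‖x₀ - z‖ ^ 2), HasDerivAt G (G₁ s) s)
    (hG₁ : HasDerivAt G₁ g₂ (‖x₀ - z‖ ^ 2))
    (hE : HasDerivAt E e₁ t₀) (hζ : HasDerivAt ζ ζ₁ t₀) :
    IsParabolicSubjet (fun p => -(ζ p.2 + E p.2 * G (‖p.1 - z‖ ^ 2))) x₀ t₀
      (-(ζ₁ + e₁ * G (‖x₀ - z‖ ^ 2)))
      (-(2 * E t₀ * G₁ (‖x₀ - z‖ ^ 2)) • (x₀ - z))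
      (-((2 * E t₀ * G₁ (‖x₀ - z‖ ^ 2)) • 1 + (4 * E t₀ * g₂) • tensorSq (x₀ - z))) := by
  refine ⟨(smul_one_add_smul_tensorSq_isSymm _ _ _).neg, ?_⟩
  set s₀ := ‖x₀ - z‖ ^ 2 with hs₀
  set w := x₀ - z with hw
  let N : EuclideanSpace ℝ (Fin n) × ℝ → ℝ := fun p => |p.2 - t₀| + ‖p.1 - x₀‖ ^ 2
  let S : EuclideanSpace ℝ (Fin n) × ℝ → ℝ := fun p => ‖p.1 - z‖ ^ 2
  have hNt : (fun p : EuclideanSpace ℝ (Fin n) × ℝ => p.2 - t₀) =O[𝓝 (x₀, t₀)] N := by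
    refine IsBigO.of_bound 1 (Eventually.of_forall fun p => ?_)
    rw [Real.norm_eq_abs, Real.norm_eq_abs, abs_of_nonneg (by positivity : 0 ≤ N p)]
    have := sq_nonneg ‖p.1 - x₀‖
    simp only [N]
    linarith
  have hNx : (fun p : EuclideanSpace ℝ (Fin n) × ℝ => ‖p.1 - x₀‖ ^ 2) =O[𝓝 (x₀, t₀)] N := by
    refine IsBigO.of_bound 1 (Eventually.of_forall fun p => ?_)
    rw [Real.norm_eq_abs, Real.norm_eq_abs, abs_of_nonneg (by positivity : 0 ≤ N p),
      abs_of_nonneg (by positivity)]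
    have := abs_nonneg (p.2 - t₀)
    simp only [N]
    linarith
  have hsnd : Tendsto (fun p : EuclideanSpace ℝ (Fin n) × ℝ => p.2) (𝓝 (x₀, t₀)) (𝓝 t₀) :=
    continuous_snd.tendsto _
  have hS : Tendsto S (𝓝 (x₀, t₀)) (𝓝 s₀) :=
    (by fun_prop : Continuous S).tendsto (x₀, t₀)
  have hSexp : ∀ p, S p - s₀ = 2 * inner ℝ w (p.1 - x₀) + ‖p.1 - x₀‖ ^ 2 := by
    intro p
    have : p.1 - z = w + (p.1 - x₀) := by rw [hw]; abel
    simp only [S, this, norm_add_sq_real, hs₀]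
    ring
  have hnorm0 : Tendsto (fun p : EuclideanSpace ℝ (Fin n) × ℝ => ‖p.1 - x₀‖)
      (𝓝 (x₀, t₀)) (𝓝 0) := by
    have : Continuous fun p : EuclideanSpace ℝ (Fin n) × ℝ => ‖p.1 - x₀‖ := by fun_prop
    simpa using this.tendsto (x₀, t₀)
  have hin : (fun p : EuclideanSpace ℝ (Fin n) × ℝ => inner ℝ w (p.1 - x₀))
      =O[𝓝 (x₀, t₀)] fun p => ‖p.1 - x₀‖ := by
    refine IsBigO.of_bound ‖w‖ (Eventually.of_forall fun p => ?_)
    rw [norm_norm]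
    exact norm_inner_le_norm w _
  have hsq_o : (fun p : EuclideanSpace ℝ (Fin n) × ℝ => ‖p.1 - x₀‖ ^ 2)
      =o[𝓝 (x₀, t₀)] fun p => ‖p.1 - x₀‖ := by
    have := ((isLittleO_one_iff ℝ).2 hnorm0).mul_isBigO (isBigO_refl
      (fun p : EuclideanSpace ℝ (Fin n) × ℝ => ‖p.1 - x₀‖) (𝓝 (x₀, t₀)))
    simpa [sq] using this
  have hSO : (fun p => S p - s₀) =O[𝓝 (x₀, t₀)] fun p => ‖p.1 - x₀‖ := by
    simp only [hSexp]
    exact (hin.const_mul_left 2).add hsq_o.isBigO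
  have r1 : (fun p => G (S p) - G s₀ - G₁ s₀ * (S p - s₀) - g₂ / 2 * (S p - s₀) ^ 2)
      =o[𝓝 (x₀, t₀)] N :=
    (((taylor_two_isLittleO hG hG₁).comp_tendsto hS).trans_isBigO (hSO.pow 2)).trans_isBigO hNx
  -- Difference of squares: one factor is `|x - x₀|²`, the other is `O(|x - x₀|)`.
  have r2 : (fun p => (S p - s₀) ^ 2 - 4 * inner ℝ w (p.1 - x₀) ^ 2) =o[𝓝 (x₀, t₀)] N := by
    have h1 : (fun p : EuclideanSpace ℝ (Fin n) × ℝ =>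
        ‖p.1 - x₀‖ ^ 2 * (S p - s₀ + 2 * inner ℝ w (p.1 - x₀)))
        =o[𝓝 (x₀, t₀)] fun p => ‖p.1 - x₀‖ * ‖p.1 - x₀‖ :=
      hsq_o.mul_isBigO (hSO.add (hin.const_mul_left 2))
    refine (h1.congr (fun p => ?_) (fun p => (sq _).symm)).trans_isBigO hNx
    rw [hSexp]
    ring
  have r3 : (fun p : EuclideanSpace ℝ (Fin n) × ℝ => E p.2 - E t₀ - (p.2 - t₀) * e₁)
      =o[𝓝 (x₀, t₀)] N := by
    have := (hE.isLittleO.comp_tendsto hsnd).trans_isBigO hNt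
    simpa [Function.comp_def] using this
  have r4 : (fun p : EuclideanSpace ℝ (Fin n) × ℝ => ζ p.2 - ζ t₀ - (p.2 - t₀) * ζ₁)
      =o[𝓝 (x₀, t₀)] N := by
    have := (hζ.isLittleO.comp_tendsto hsnd).trans_isBigO hNt
    simpa [Function.comp_def] using this
  have r5 : (fun p => (E p.2 - E t₀) * (G (S p) - G s₀)) =o[𝓝 (x₀, t₀)] N := by
    have h1 : (fun p : EuclideanSpace ℝ (Fin n) × ℝ => E p.2 - E t₀) =O[𝓝 (x₀, t₀)] N :=
      (hE.isBigO_sub.comp_tendsto hsnd).trans hNt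
    have h2 : (fun p => G (S p) - G s₀) =o[𝓝 (x₀, t₀)] fun _ => (1 : ℝ) := by
      refine (isLittleO_one_iff ℝ).2 ?_
      have := (hG.self_of_nhds.continuousAt.tendsto.comp hS).sub_const (G s₀)
      simpa using this
    simpa using h1.mul_isLittleO h2
  -- Uses `E G - E₀ G₀ = E₀ (G - G₀) + G₀ (E - E₀) + (E - E₀)(G - G₀)`, the mixed product being
  -- negligible by `r5`.
  have key := ((((r1.const_mul_left (E t₀)).add (r2.const_mul_left (E t₀ * g₂ / 2))).add
    (r3.const_mul_left (G s₀))).add r4).add r5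
  intro ε hε
  filter_upwards [key.def hε] with p hp
  rw [Real.norm_eq_abs, Real.norm_eq_abs, abs_of_nonneg (by positivity : 0 ≤ N p)] at hp
  have h3 := (abs_le.1 hp).2
  have hquad : quadForm (-((2 * E t₀ * G₁ s₀) • (1 : RMat n) + (4 * E t₀ * g₂) • tensorSq w))
      (p.1 - x₀) = -(2 * E t₀ * G₁ s₀) * ‖p.1 - x₀‖ ^ 2
        + -(4 * E t₀ * g₂) * inner ℝ w (p.1 - x₀) ^ 2 := by
    rw [← quadForm_smul_one_add_smul_tensorSq]
    congr 1
    module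
  rw [hquad, real_inner_smul_left]
  change _ ≤ -(ζ p.2 + E p.2 * G (S p))
  linear_combination h3 + (E t₀ * G₁ s₀) * hSexp p

end Subjets

/-- Serves to send each small parameter (`η`, `ε`, `δ`) to `0` in turn. -/
lemma le_of_eventually_sub_mul_le {a b d : ℝ} (h : ∀ᶠ ε in 𝓝[>] (0 : ℝ), a - ε * b ≤ d) :
    a ≤ d := by
  have ht : Tendsto (fun ε : ℝ => a - ε * b) (𝓝[>] 0) (𝓝 a) := by
    have : Continuous fun ε : ℝ => a - ε * b := by fun_prop
    simpa using (this.tendsto 0).mono_left nhdsWithin_le_nhds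
  exact le_of_tendsto ht h

/-! ### The general barrier argument. -/

section Barrier

variable {n : ℕ} {H : EuclideanSpace ℝ (Fin n) → RMat n → ℝ} {Z χ : ℝ → ℝ} {σ T : ℝ}
  {u : EuclideanSpace ℝ (Fin n) × ℝ → ℝ}

/-- Comparison of a super-solution with the barrier
`c - κ t - ε e^{B t} G(|x - z|²)`, where `G` outgrows `-u`. -/
lemma IsViscositySupersolution.barrier_le (hA : ConditionA H) (hB : ConditionB H 0)
    (hZ : ∀ s, 0 ≤ Z s) (hu : IsViscositySupersolution H Z χ σ T u)
    (hulsc : LowerSemicontinuousOn u (univ ×ˢ Ico 0 T))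
    {G G₁ G₂ : ℝ → ℝ} (hG : ∀ s, -1 < s → HasDerivAt G (G₁ s) s)
    (hG₁ : ∀ s, 0 ≤ s → HasDerivAt G₁ (G₂ s) s) (hGnonneg : ∀ s, 0 ≤ s → 0 ≤ G s)
    {z : EuclideanSpace ℝ (Fin n)} {ε b κ c : ℝ} (hε : 0 < ε) (hb : 0 ≤ b) (hκ : 0 ≤ κ)
    (hc : ∀ x, c ≤ u (x, 0))
    (hop : ∀ t ∈ Ioo 0 T, ∀ w : EuclideanSpace ℝ (Fin n),
      |χ t| * ‖-(2 * (ε * Real.exp (b * t)) * G₁ (‖w‖ ^ 2)) • w‖ ^ σ ≤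
        H 0 (-((2 * (ε * Real.exp (b * t)) * G₁ (‖w‖ ^ 2)) • 1
          + (4 * (ε * Real.exp (b * t)) * G₂ (‖w‖ ^ 2)) • tensorSq w))
        + κ + b * (ε * Real.exp (b * t) * G (‖w‖ ^ 2)))
    (hbdd : ∀ R : ℝ, BddAbove ((fun p => -u p) '' cylinder z T R))
    (hgrow : ∀ᶠ R : ℝ in atTop,
      sSup ((fun p => -u p) '' cylinder z T R) ≤ ε * G (R ^ 2) - c)
    (x : EuclideanSpace ℝ (Fin n)) {t : ℝ} (ht : t ∈ Ioo 0 T) :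
    c - κ * t - ε * (Real.exp (b * t) * G (‖x - z‖ ^ 2)) ≤ u (x, t) := by
  -- The extra penalty `η/(T - t)` replaces missing information at time `T`, and its derivative
  -- makes the barrier inequality strict.
  refine le_of_eventually_sub_mul_le (b := (T - t)⁻¹) ?_
  filter_upwards [self_mem_nhdsWithin] with η hη
  have hη : 0 < η := hη
  obtain ⟨R, hR, hxR⟩ := (hgrow.and (eventually_ge_atTop ‖x - z‖)).exists
  set M := sSup ((fun p => -u p) '' cylinder z T R)
  have hM : ∀ y s, ‖y - z‖ ≤ R → s ∈ Ioo 0 T → -M ≤ u (y, s) := by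
    intro y s hy hs
    have : -u (y, s) ≤ M :=
      le_csSup (hbdd R) ⟨(y, s), ⟨by simpa [dist_eq_norm] using hy, hs⟩, rfl⟩
    linarith
  -- The cylinder is cut at time `T - δ`: late enough to contain `t`, and so close to `T` that the
  -- penalty alone pushes `v` below `-M`.
  obtain ⟨δ, hδ, hδt, hδM⟩ : ∃ δ, 0 < δ ∧ δ ≤ T - t ∧ M + c ≤ η * δ⁻¹ := by
    have hpos : 0 < |M + c| + 1 := by positivity
    refine ⟨min (T - t) (η / (|M + c| + 1)), lt_min (by linarith [ht.2]) (by positivity),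
      min_le_left _ _, ?_⟩
    set δ := min (T - t) (η / (|M + c| + 1))
    have hδ : 0 < δ := lt_min (by linarith [ht.2]) (by positivity)
    have h1 : δ * (|M + c| + 1) ≤ η := (le_div_iff₀ hpos).1 (min_le_right _ _)
    rw [← div_eq_mul_inv, le_div_iff₀ hδ]
    nlinarith [le_abs_self (M + c)]
  let E : ℝ → ℝ := fun s => ε * Real.exp (b * s)
  let ζ : ℝ → ℝ := fun s => -c + κ * s + η * (T - s)⁻¹
  let v : EuclideanSpace ℝ (Fin n) × ℝ → ℝ := fun p => -(ζ p.2 + E p.2 * G (‖p.1 - z‖ ^ 2))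
  have hE : ∀ s, HasDerivAt E (b * E s) s := by
    intro s
    have := ((((hasDerivAt_id s).const_mul b).exp).const_mul ε)
    refine this.congr_deriv ?_
    simp [E]
    ring
  have hζ : ∀ s, s < T → HasDerivAt ζ (κ + η * ((T - s)⁻¹) ^ 2) s := by
    intro s hs
    have h1 := (((hasDerivAt_id s).const_sub T).inv (sub_pos.2 hs).ne').const_mul η
    have h2 := (((hasDerivAt_id s).const_mul κ).const_add (-c)).add h1
    refine h2.congr_deriv ?_
    simp
  have hvle : ∀ y s, 0 ≤ s → v (y, s) ≤ c - η * (T - s)⁻¹ - ε * G (‖y - z‖ ^ 2) := by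
    intro y s hs
    have h1 : 0 ≤ G (‖y - z‖ ^ 2) := hGnonneg _ (by positivity)
    have h2 : 1 ≤ Real.exp (b * s) := Real.one_le_exp (by positivity)
    have h3 : ε * G (‖y - z‖ ^ 2) ≤ E s * G (‖y - z‖ ^ 2) :=
      mul_le_mul_of_nonneg_right (le_mul_of_one_le_right hε.le h2) h1
    have h4 : 0 ≤ κ * s := by positivity
    simp only [v, ζ]
    linarith
  have hεG : ∀ y, 0 ≤ ε * G (‖y - z‖ ^ 2) := fun y =>
    mul_nonneg hε.le (hGnonneg _ (by positivity))
  have key : v (x, t) ≤ u (x, t) := by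
    refine hu.le_of_le_boundary hulsc ?_ ?_ (z := z) (R := R) (τ := T - δ) (by linarith)
      ?_ ?_ ?_ hxR ⟨ht.1.le, by linarith⟩
    · have hGc : Continuous fun p : EuclideanSpace ℝ (Fin n) × ℝ => G (‖p.1 - z‖ ^ 2) :=
        continuous_iff_continuousAt.2 fun p =>
          (hG (‖p.1 - z‖ ^ 2) (by linarith [sq_nonneg ‖p.1 - z‖])).continuousAt.comp
            (f := fun p : EuclideanSpace ℝ (Fin n) × ℝ => ‖p.1 - z‖ ^ 2)
            (by fun_prop : Continuous fun p : EuclideanSpace ℝ (Fin n) × ℝ =>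
              ‖p.1 - z‖ ^ 2).continuousAt
      have hζc : ContinuousOn (fun p : EuclideanSpace ℝ (Fin n) × ℝ => ζ p.2)
          (univ ×ˢ Ico 0 T) := fun p hp =>
        ((hζ p.2 hp.2.2).continuousAt.comp continuous_snd.continuousAt).continuousWithinAt
      have hEc : Continuous E := by fun_prop
      exact (hζc.add ((hEc.comp continuous_snd).mul hGc).continuousOn).neg
    · intro y s hs
      set w := y - z with hw
      have hsub := isParabolicSubjet_radial z y (G := G) (G₁ := G₁)
        -- Differentiability of `G` beyond `s ≥ 0` gives the two-sided neighbourhood needed at `w =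
        -- 0`.
        (((lt_mem_nhds (by linarith [sq_nonneg ‖w‖] : -1 < ‖w‖ ^ 2))).mono hG)
        (hG₁ _ (sq_nonneg _)) (hE s) (hζ s hs.2)
      refine ⟨_, _, _, hsub, lt_of_lt_of_le ?_ (hA.le_parabolicOp (hZ _) _ hsub.1)⟩
      rw [hB.eq_of_isSymm hsub.1 _ 0]
      have h1 := hop s hs w
      have h2 : 0 < η * ((T - s)⁻¹) ^ 2 := by
        have : 0 < T - s := sub_pos.2 hs.2
        positivity
      have h3 := mul_le_mul_of_nonneg_right (neg_abs_le (χ s))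
        (Real.rpow_nonneg (norm_nonneg (-(2 * E s * G₁ (‖w‖ ^ 2)) • w)) σ)
      simp only [E] at h3 ⊢
      linarith
    · intro y
      refine le_trans ?_ (hc y)
      have h1 : 0 ≤ η * (T - 0)⁻¹ := by
        have : 0 < T - 0 := by linarith [ht.1, ht.2]
        positivity
      linarith [hvle y 0 le_rfl, hεG y]
    · intro y hy
      have hmem : T - δ ∈ Ioo 0 T := ⟨by linarith [ht.1], by linarith⟩
      refine le_trans ?_ (hM y _ hy hmem)
      have := hvle y (T - δ) hmem.1.le
      rw [sub_sub_cancel] at this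
      linarith [hεG y]
    · intro y hy s hs
      refine le_trans ?_ (hM y s hy.le hs)
      have h1 := hvle y s hs.1.le
      rw [hy] at h1
      have h2 : 0 < η * (T - s)⁻¹ := by
        have : 0 < T - s := sub_pos.2 hs.2
        positivity
      linarith
  refine le_trans (le_of_eq ?_) key
  simp only [v, ζ, E]
  ring

end Barrier

/-! ### The growth conditions in the form used on the lateral boundary. -/

section Growth

variable {n : ℕ} {f : EuclideanSpace ℝ (Fin n) × ℝ → ℝ} {z : EuclideanSpace ℝ (Fin n)}
  {T s : ℝ}

lemma SupIsExpLittleO.eventually_le (hf : SupIsExpLittleO f z T s) (hs : 0 < s) {ε : ℝ}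
    (hε : 0 < ε) (c : ℝ) :
    ∀ᶠ R : ℝ in atTop, sSup (f '' cylinder z T R) ≤ ε * Real.exp (R ^ s) - c := by
  -- With `y = e^{R^s/2}`, eventually `sup ≤ y`, while `ε e^{R^s} = ε y² ≥ (1 + |c|) y ≥ y + |c|`.
  have hy : Tendsto (fun R : ℝ => Real.exp (1 / 2 * R ^ s)) atTop atTop :=
    Real.tendsto_exp_atTop.comp ((tendsto_rpow_atTop hs).const_mul_atTop (by norm_num))
  filter_upwards [hf.2.def (by norm_num : (0 : ℝ) < 1 / 2), eventually_ge_atTop 0,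
    hy.eventually_ge_atTop ((1 + |c|) / ε), hy.eventually_ge_atTop 1] with R hR hR0 h1 h2
  set y := Real.exp (1 / 2 * R ^ s)
  have hexp : Real.exp (R ^ s) = y * y := by
    rw [← Real.exp_add]
    ring_nf
  have hsup : sSup (f '' cylinder z T R) ≤ y := by
    rcases le_or_gt (sSup (f '' cylinder z T R)) 0 with h0 | h0
    · exact h0.trans (Real.exp_pos _).le
    · rw [max_eq_left h0.le, Real.norm_eq_abs, Real.norm_eq_abs,
        abs_of_nonneg (Real.rpow_nonneg hR0 s)] at hR
      exact (Real.log_le_iff_le_exp h0).1 ((le_abs_self _).trans hR)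
  rw [hexp]
  rw [div_le_iff₀ hε] at h1
  nlinarith [le_abs_self c, mul_le_mul_of_nonneg_right h1 (by linarith : 0 ≤ y),
    mul_nonneg (abs_nonneg c) (sub_nonneg.2 h2)]

lemma SupIsLittleO.eventually_le (hf : SupIsLittleO f z T s) (hs : 0 < s) {ε : ℝ}
    (hε : 0 < ε) (c : ℝ) :
    ∀ᶠ R : ℝ in atTop, sSup (f '' cylinder z T R) ≤ ε * R ^ s - c := by
  filter_upwards [hf.2.def (half_pos hε), eventually_ge_atTop 0,
    ((tendsto_rpow_atTop hs).const_mul_atTop (half_pos hε)).eventually_ge_atTop c]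
    with R hR hR0 h1
  rw [Real.norm_eq_abs, Real.norm_eq_abs, abs_of_nonneg (Real.rpow_nonneg hR0 s)] at hR
  linarith [le_abs_self (sSup (f '' cylinder z T R))]

end Growth

/-- A sublinear power is bounded by an arbitrarily small constant plus a linear function. -/
lemma exists_rpow_le_add_mul {σ δ : ℝ} (hσ : 0 < σ) (hσ1 : σ ≤ 1) (hδ : 0 < δ) :
    ∃ M : ℝ, 0 ≤ M ∧ ∀ y : ℝ, 0 ≤ y → y ^ σ ≤ δ + M * y := by
  -- The threshold where `y ^ σ = δ`: the constant suffices below it, the linear term above it.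
  set y₀ := δ ^ σ⁻¹
  have hy₀ : 0 < y₀ := Real.rpow_pos_of_pos hδ _
  have hpow : y₀ ^ σ = δ := Real.rpow_inv_rpow hδ.le hσ.ne'
  refine ⟨y₀ ^ (σ - 1), (Real.rpow_pos_of_pos hy₀ _).le, fun y hy => ?_⟩
  have hM : 0 < y₀ ^ (σ - 1) := Real.rpow_pos_of_pos hy₀ _
  rcases le_total y y₀ with h | h
  · have := Real.rpow_le_rpow hy h hσ.le
    rw [hpow] at this
    nlinarith [mul_nonneg hM.le hy]
  · have hy' : 0 < y := hy₀.trans_le h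
    have h1 : y ^ (σ - 1) ≤ y₀ ^ (σ - 1) :=
      Real.rpow_le_rpow_of_nonpos hy₀ h (by linarith)
    have h2 : y ^ σ = y ^ (σ - 1) * y := by
      rw [← Real.rpow_add_one hy'.ne', sub_add_cancel]
    rw [h2]
    nlinarith [mul_le_mul_of_nonneg_right h1 hy]

/-- The profile for (b): `e^{√(1+|x|²)}` grows like `e^{|x|}`, and the `1 +` keeps it smooth at the
origin. -/
lemma hasDerivAt_exp_sqrt_one_add {s : ℝ} (hs : -1 < s) :
    HasDerivAt (fun s => Real.exp (√(1 + s))) (Real.exp (√(1 + s)) / (2 * √(1 + s))) s := by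
  have h := ((((hasDerivAt_id s).const_add 1).sqrt (by simp; linarith)).exp)
  refine h.congr_deriv ?_
  simp
  ring

lemma hasDerivAt_exp_sqrt_one_add_div {s : ℝ} (hs : 0 ≤ s) :
    HasDerivAt (fun s => Real.exp (√(1 + s)) / (2 * √(1 + s)))
      (Real.exp (√(1 + s)) * (√(1 + s) - 1) / (4 * √(1 + s) ^ 3)) s := by
  have hr : 0 < √(1 + s) := Real.sqrt_pos.2 (by linarith)
  have h1 := ((hasDerivAt_id s).const_add 1).sqrt (by simp; linarith)
  have h := (hasDerivAt_exp_sqrt_one_add (by linarith : -1 < s)).div (h1.const_mul 2)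
    (by simp; positivity)
  refine h.congr_deriv ?_
  simp only [id]
  field_simp
  ring

lemma hasDerivAt_one_add_rpow {s : ℝ} (hs : -1 < s) (p : ℝ) :
    HasDerivAt (fun s : ℝ => (1 + s) ^ p) (p * (1 + s) ^ (p - 1)) s := by
  have h := ((hasDerivAt_id s).const_add 1).rpow_const (p := p) (Or.inl (by simp; linarith))
  refine h.congr_deriv ?_
  simp

/-! ### The three ranges of `σ`. -/

section Cases

variable {n : ℕ} {H : EuclideanSpace ℝ (Fin n) → RMat n → ℝ} {Z χ : ℝ → ℝ} {σ T : ℝ}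
  {u : EuclideanSpace ℝ (Fin n) × ℝ → ℝ} {z : EuclideanSpace ℝ (Fin n)} {c K : ℝ}

/-- For `G = exp` all derivatives equal `G`, so the loss `C · 2EG` in `H` is exactly paid by `b =
2C`. The gradient factor is `1`, hence `κ = K` survives in the conclusion. -/
lemma IsViscositySupersolution.lower_bound_of_exponent_zero
    (hn : 2 ≤ n) (hA : ConditionA H) (hB : ConditionB H 0)
    (hZ : ∀ s, 0 ≤ Z s) (hu : IsViscositySupersolution H Z χ 0 T u)
    (hulsc : LowerSemicontinuousOn u (univ ×ˢ Ico 0 T))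
    (hc : ∀ x, c ≤ u (x, 0)) (hK : 0 ≤ K) (hχ : ∀ t ∈ Ioo 0 T, |χ t| ≤ K)
    (hI : LambdaInfFinite H) (hgrow : SupIsExpLittleO (fun p => -u p) z T 2)
    (x : EuclideanSpace ℝ (Fin n)) {t : ℝ} (ht : t ∈ Ioo 0 T) :
    c - K * t ≤ u (x, t) := by
  obtain ⟨C, hC, hH⟩ := exists_bound_of_lambdaInfFinite hn hA hB hI
  refine le_of_eventually_sub_mul_le
    (b := Real.exp (2 * C * t) * Real.exp (‖x - z‖ ^ 2)) ?_
  filter_upwards [self_mem_nhdsWithin] with ε hε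
  have hε : 0 < ε := hε
  refine hu.barrier_le hA hB hZ hulsc (G := Real.exp) (fun s _ => Real.hasDerivAt_exp s)
    (fun s _ => Real.hasDerivAt_exp s) (fun s _ => (Real.exp_pos s).le) hε
    (by positivity) hK hc (fun s hs w => ?_) hgrow.1 ?_ x ht
  · have h1 := hH 0 w (2 * (ε * Real.exp (2 * C * s)) * Real.exp (‖w‖ ^ 2))
      (4 * (ε * Real.exp (2 * C * s)) * Real.exp (‖w‖ ^ 2)) (by positivity) (by positivity)
    rw [Real.rpow_zero, mul_one]
    linarith [hχ s hs]
  · simpa using hgrow.eventually_le two_pos hε c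

/-- Here the barrier's gradient is bounded by its growing part `EG`, so `|Dv|^σ ≤ δ + M E G`: the
constant goes into `κ = K δ`, the rest into `b`. As `M` depends on `δ`, `ε` tends to `0` before `δ`
does. -/
lemma IsViscositySupersolution.lower_bound_of_exponent_le_one
    (hn : 2 ≤ n) (hA : ConditionA H) (hB : ConditionB H 0)
    (hZ : ∀ s, 0 ≤ Z s) (hu : IsViscositySupersolution H Z χ σ T u)
    (hulsc : LowerSemicontinuousOn u (univ ×ˢ Ico 0 T))
    (hc : ∀ x, c ≤ u (x, 0)) (hK : 0 ≤ K) (hχ : ∀ t ∈ Ioo 0 T, |χ t| ≤ K)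
    (hI : LambdaInfFinite H) (hσ : 0 < σ) (hσ1 : σ ≤ 1)
    (hgrow : SupIsExpLittleO (fun p => -u p) z T 1)
    (x : EuclideanSpace ℝ (Fin n)) {t : ℝ} (ht : t ∈ Ioo 0 T) :
    c ≤ u (x, t) := by
  obtain ⟨C, hC, hH⟩ := exists_bound_of_lambdaInfFinite hn hA hB hI
  refine le_of_eventually_sub_mul_le (b := K * t) ?_
  filter_upwards [self_mem_nhdsWithin] with δ hδ
  have hδ : 0 < δ := hδ
  obtain ⟨M, hM, hpow⟩ := exists_rpow_le_add_mul hσ hσ1 hδ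
  have hδK : c - δ * (K * t) = c - K * δ * t := by ring
  rw [hδK]
  refine le_of_eventually_sub_mul_le
    (b := Real.exp ((C + K * M) * t) * Real.exp (√(1 + ‖x - z‖ ^ 2))) ?_
  filter_upwards [self_mem_nhdsWithin] with ε hε
  have hε : 0 < ε := hε
  refine hu.barrier_le hA hB hZ hulsc (G := fun s => Real.exp (√(1 + s)))
    (fun s hs => hasDerivAt_exp_sqrt_one_add hs)
    (fun s hs => hasDerivAt_exp_sqrt_one_add_div hs) (fun s _ => (Real.exp_pos _).le) hε
    (by positivity) (by positivity) hc (fun s hs w => ?_) hgrow.1 ?_ x ht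
  · set r := √(1 + ‖w‖ ^ 2)
    set E := ε * Real.exp ((C + K * M) * s)
    have hE : 0 < E := by positivity
    have hr1 : 1 ≤ r := Real.one_le_sqrt.2 (by linarith [sq_nonneg ‖w‖])
    have hr : 0 < r := by linarith
    have hwr : ‖w‖ ≤ r := Real.le_sqrt_of_sq_le (by linarith)
    have hY : 0 < E * Real.exp r := by positivity
    have ha : 2 * E * (Real.exp r / (2 * r)) = E * Real.exp r / r := by field_simp
    have hb : 0 ≤ 4 * E * (Real.exp r * (r - 1) / (4 * r ^ 3)) := by
      have : 0 ≤ r - 1 := by linarith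
      positivity
    have h1 := hH 0 w (2 * E * (Real.exp r / (2 * r))) _ (by positivity) hb
    have h2 : ‖-(2 * E * (Real.exp r / (2 * r))) • w‖ ≤ E * Real.exp r := by
      rw [norm_smul, norm_neg, Real.norm_eq_abs, abs_of_nonneg (by positivity), ha,
        div_mul_eq_mul_div, div_le_iff₀ hr]
      exact mul_le_mul_of_nonneg_left hwr hY.le
    have h3 : 2 * E * (Real.exp r / (2 * r)) ≤ E * Real.exp r := by
      rw [ha]
      exact div_le_self hY.le hr1
    have h4 := hpow _ (norm_nonneg (-(2 * E * (Real.exp r / (2 * r))) • w))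
    have h5 : ‖-(2 * E * (Real.exp r / (2 * r))) • w‖ ^ σ ≤ δ + M * (E * Real.exp r) :=
      h4.trans (by gcongr)
    have h6 : |χ s| * ‖-(2 * E * (Real.exp r / (2 * r))) • w‖ ^ σ
        ≤ K * (δ + M * (E * Real.exp r)) :=
      mul_le_mul (hχ s hs) h5 (by positivity) hK
    have h7 := mul_le_mul_of_nonneg_left h3 hC
    linarith
  · filter_upwards [hgrow.eventually_le one_pos hε c] with R hR
    refine hR.trans ?_
    rw [Real.rpow_one]
    have : R ≤ √(1 + R ^ 2) := Real.le_sqrt_of_sq_le (by linarith)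
    gcongr

/-- The exponent `p = σ*` is the one for which `|D(|x|^p)|^σ` grows like `|x|^p`. The gradient term
is then of order `E^σ G`, and `σ > 1` makes it smaller than `E G` for small `ε`. -/
lemma IsViscositySupersolution.lower_bound_of_one_lt_exponent
    (hA : ConditionA H) (hB : ConditionB H 0)
    (hZ : ∀ s, 0 ≤ Z s) (hu : IsViscositySupersolution H Z χ σ T u)
    (hulsc : LowerSemicontinuousOn u (univ ×ˢ Ico 0 T))
    (hc : ∀ x, c ≤ u (x, 0)) (hK : 0 ≤ K) (hχ : ∀ t ∈ Ioo 0 T, |χ t| ≤ K)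
    (hσ : 1 < σ) (hgrow : SupIsLittleO (fun p => -u p) z T (σ / (σ - 1)))
    (x : EuclideanSpace ℝ (Fin n)) {t : ℝ} (ht : t ∈ Ioo 0 T) :
    c ≤ u (x, t) := by
  set p := σ / (σ - 1) with hp
  have hσ0 : 0 < σ - 1 := by linarith
  have hp0 : 0 < p := by positivity
  have hpσ : (p - 1) * σ = p := by
    rw [hp]
    field_simp
    ring
  set D := max 0 (-H 0 (-1))
  have hD : 0 ≤ D := le_max_left _ _
  have hDH : -D ≤ H 0 (-1) := by linarith [le_max_right 0 (-H 0 (-1))]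
  -- `p` bounds the tangential eigenvalue of the Hessian, `p |p - 2|` the additional radial part,
  -- both relative to `E g`.
  set m := p + p * |p - 2|
  have hm : 0 < m := by positivity
  -- `D * m` pays for `H`, the `1` for the gradient term through `hsmall`.
  set b := D * m + 1
  have hb : 0 ≤ b := by positivity
  have hsmall : ∀ᶠ ε in 𝓝[>] (0 : ℝ), K * p ^ σ * (ε * Real.exp (b * T)) ^ (σ - 1) ≤ 1 := by
    have hcont : ContinuousAt
        (fun ε : ℝ => K * p ^ σ * (ε * Real.exp (b * T)) ^ (σ - 1)) 0 :=
      continuousAt_const.mul ((by fun_prop : ContinuousAt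
        (fun ε : ℝ => ε * Real.exp (b * T)) 0).rpow_const (Or.inr hσ0.le))
    refine nhdsWithin_le_nhds ((hcont.tendsto.eventually_lt_const ?_).mono fun _ h => h.le)
    simp [Real.zero_rpow hσ0.ne']
  refine le_of_eventually_sub_mul_le
    (b := Real.exp (b * t) * (1 + ‖x - z‖ ^ 2) ^ (p / 2)) ?_
  filter_upwards [self_mem_nhdsWithin, hsmall] with ε hε hεsmall
  have hε : 0 < ε := hε
  have key := hu.barrier_le hA hB hZ hulsc (G := fun s => (1 + s) ^ (p / 2))
    (G₁ := fun s => p / 2 * (1 + s) ^ (p / 2 - 1))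
    (G₂ := fun s => p / 2 * ((p / 2 - 1) * (1 + s) ^ (p / 2 - 1 - 1)))
    (fun s hs => hasDerivAt_one_add_rpow hs _)
    (fun s hs => (hasDerivAt_one_add_rpow (by linarith) _).const_mul _)
    (fun s hs => by positivity) hε hb le_rfl hc (fun s hs w => ?_) hgrow.1 ?_ x ht
  · simpa using key
  · set y := 1 + ‖w‖ ^ 2
    have hy1 : 1 ≤ y := by simp only [y]; linarith [sq_nonneg ‖w‖]
    have hy : 0 < y := by linarith
    set E := ε * Real.exp (b * s)
    have hE : 0 < E := by positivity
    have hET : E ≤ ε * Real.exp (b * T) := by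
      have := hs.2.le
      simp only [E]
      gcongr
    set g := y ^ (p / 2)
    have hg : 0 < g := by positivity
    have hg1 : y ^ (p / 2 - 1) ≤ g := Real.rpow_le_rpow_of_exponent_le hy1 (by linarith)
    have hg2 : y ^ (p / 2 - 1 - 1) * ‖w‖ ^ 2 ≤ g := by
      refine le_trans ?_ hg1
      rw [← sub_add_cancel (p / 2 - 1) 1, Real.rpow_add_one hy.ne', add_sub_cancel_right]
      refine mul_le_mul_of_nonneg_left ?_ (by positivity)
      simp only [y]
      linarith
    have ha : 2 * E * (p / 2 * y ^ (p / 2 - 1)) ≤ E * p * g := by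
      have := mul_le_mul_of_nonneg_left hg1 (by positivity : 0 ≤ E * p)
      linarith
    have ha2 : 4 * E * (p / 2 * ((p / 2 - 1) * y ^ (p / 2 - 1 - 1))) * ‖w‖ ^ 2
        ≤ E * (p * |p - 2|) * g := by
      have h1 : (p - 2) * (y ^ (p / 2 - 1 - 1) * ‖w‖ ^ 2) ≤ |p - 2| * g :=
        mul_le_mul (le_abs_self _) hg2 (by positivity) (abs_nonneg _)
      have := mul_le_mul_of_nonneg_left h1 (by positivity : 0 ≤ E * p)
      linarith
    have hop := le_neg_of_eigenvalues_le hA hB 0 w (τ := E * m * g)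
      (b := 4 * E * (p / 2 * ((p / 2 - 1) * y ^ (p / 2 - 1 - 1)))) (by positivity)
      (ha.trans (by
        have : 0 ≤ E * (p * |p - 2|) * g := by positivity
        simp only [m]
        linarith))
      (by
        simp only [m]
        linarith)
    have hgrad : ‖-(2 * E * (p / 2 * y ^ (p / 2 - 1))) • w‖ ≤ E * p * y ^ ((p - 1) / 2) := by
      have hw : ‖w‖ ≤ y ^ (1 / 2 : ℝ) := by
        rw [← Real.sqrt_eq_rpow]
        exact Real.le_sqrt_of_sq_le (by simp only [y]; linarith)
      have hsplit : y ^ ((p - 1) / 2) = y ^ (p / 2 - 1) * y ^ (1 / 2 : ℝ) := by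
        rw [← Real.rpow_add hy]
        ring_nf
      rw [norm_smul, norm_neg, Real.norm_eq_abs, abs_of_nonneg (by positivity), hsplit]
      have := mul_le_mul_of_nonneg_left hw
        (by positivity : 0 ≤ E * p * y ^ (p / 2 - 1))
      linarith
    have hpow : ‖-(2 * E * (p / 2 * y ^ (p / 2 - 1))) • w‖ ^ σ ≤ E ^ σ * p ^ σ * g := by
      refine (Real.rpow_le_rpow (norm_nonneg _) hgrad (by linarith)).trans_eq ?_
      rw [Real.mul_rpow (by positivity) (by positivity), Real.mul_rpow hE.le hp0.le,
        ← Real.rpow_mul hy.le]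
      congr 2
      linarith
    have hχpow := mul_le_mul (hχ s hs) hpow (by positivity) hK
    have hEσ : E ^ σ = E ^ (σ - 1) * E := by
      rw [← Real.rpow_add_one hE.ne', sub_add_cancel]
    have hKE : K * p ^ σ * E ^ (σ - 1) ≤ 1 :=
      (mul_le_mul_of_nonneg_left (Real.rpow_le_rpow hE.le hET hσ0.le)
        (by positivity)).trans hεsmall
    have h1 : K * (E ^ σ * p ^ σ * g) ≤ E * g := by
      rw [hEσ]
      have := mul_le_mul_of_nonneg_right hKE (by positivity : 0 ≤ E * g)
      linarith
    have h2 : -(E * m * g * D) ≤ E * m * g * H 0 (-1) := by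
      have := mul_le_mul_of_nonneg_left hDH (by positivity : 0 ≤ E * m * g)
      linarith
    simp only [b]
    linarith
  · filter_upwards [hgrow.eventually_le hp0 hε c, eventually_ge_atTop 0] with R hR hR0
    refine hR.trans ?_
    have h1 : R ^ p = (R ^ 2) ^ (p / 2) := by
      rw [← Real.rpow_natCast, ← Real.rpow_mul hR0]
      congr 1
      push_cast
      ring
    have h2 : (R ^ 2) ^ (p / 2) ≤ (1 + R ^ 2) ^ (p / 2) :=
      Real.rpow_le_rpow (by positivity) (by linarith) (by positivity)
    rw [h1]
    have := mul_le_mul_of_nonneg_left h2 hε.le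
    linarith

end Cases

theorem theorem2p10 {n : ℕ} (hn : 2 ≤ n) (T : ℝ) (hT : 0 < T)
    (H : EuclideanSpace ℝ (Fin n) → RMat n → ℝ)
    (hA : ConditionA H) (hB : ConditionB H 0) (hC : ConditionC H)
    (Z : ℝ → ℝ) (hZcont : Continuous Z) (hZanti : Antitone Z) (hZnonneg : ∀ s, 0 ≤ Z s)
    (χ : ℝ → ℝ) (hχcont : ContinuousOn χ (Ioo 0 T))
    (hχbdd : BddAbove ((fun t => |χ t|) '' Ioo 0 T))
    (σ : ℝ) (hσ : 0 ≤ σ)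
    (h : EuclideanSpace ℝ (Fin n) → ℝ) (hhcont : Continuous h) (hhbdd : BddBelow (range h))
    (u : EuclideanSpace ℝ (Fin n) × ℝ → ℝ)
    (hulsc : LowerSemicontinuousOn u (univ ×ˢ Ico 0 T))
    (husuper : IsViscositySupersolution H Z χ σ T u)
    (huinit : ∀ x, h x ≤ u (x, 0))
    (z : EuclideanSpace ℝ (Fin n)) :
    (LambdaInfFinite H → σ = 0 → SupIsExpLittleO (fun p => -u p) z T 2 →
      ∀ x : EuclideanSpace ℝ (Fin n), ∀ t ∈ Ioo 0 T,
        (⨅ y, h y) - t * sSup ((fun τ => |χ τ|) '' Ioo 0 T) ≤ u (x, t)) ∧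
    (LambdaInfFinite H → 0 < σ → σ ≤ 1 → SupIsExpLittleO (fun p => -u p) z T 1 →
      ∀ x : EuclideanSpace ℝ (Fin n), ∀ t ∈ Ioo 0 T, (⨅ y, h y) ≤ u (x, t)) ∧
    (1 < σ → SupIsLittleO (fun p => -u p) z T (σ / (σ - 1)) →
      ∀ x : EuclideanSpace ℝ (Fin n), ∀ t ∈ Ioo 0 T, (⨅ y, h y) ≤ u (x, t)) := by
  have hc : ∀ x, (⨅ y, h y) ≤ u (x, 0) := fun x => (ciInf_le hhbdd x).trans (huinit x)
  set K := sSup ((fun τ => |χ τ|) '' Ioo 0 T)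
  have hχ : ∀ t ∈ Ioo 0 T, |χ t| ≤ K := fun t ht => le_csSup hχbdd ⟨t, ht, rfl⟩
  have hK : 0 ≤ K := (abs_nonneg _).trans (hχ (T / 2) ⟨by linarith, by linarith⟩)
  refine ⟨fun hI hσ0 hgrow x t ht => ?_, fun hI hσ0 hσ1 hgrow x t ht => ?_,
    fun hσ1 hgrow x t ht => ?_⟩
  · subst hσ0
    rw [mul_comm]
    exact husuper.lower_bound_of_exponent_zero hn hA hB hZnonneg hulsc hc hK hχ hI hgrow x ht
  · exact husuper.lower_bound_of_exponent_le_one hn hA hB hZnonneg hulsc hc hK hχ hI hσ0 hσ1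
      hgrow x ht
  · exact husuper.lower_bound_of_one_lt_exponent hA hB hZnonneg hulsc hc hK hχ hσ1 hgrow x ht
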